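/- Let $d\ge 2$. A $\mathbb{Z}^k$-system $(X,T_1,\dots,T_k)$ consists of a compact metric space $(X,\rho)$ and $k$ pairwise commuting homeomorphisms $T_1,\dots,T_k\colon X\to X$; put $G=\langle T_1,\dots,T_k\rangle$. The system is minimal if the $G$-orbit of every point is dense in $X$, and distal if $\inf_{g\in G}\rho(gx,gy)>0$ for all $x\neq y$ in $X$. For $x\in X$ and an open neighborhood $U$ of $x$ let $$N_{T_1,\dots,T_k}(x,U)=\{(n_1,\dots,n_k)\in\mathbb{Z}^k : T_1^{n_1}\cdots T_k^{n_k}x\in U\}.$$ A set $B\subseteq\mathbb{Z}^k$ is called a set of return times of a minimal distal $\mathbb{Z}^k$-system if there exist a minimal distal $\mathbb{Z}^k$-system $(Y,S_1,\dots,S_k)$, a point $y\in Y$ and an open neighborhood $V$ of $y$ such that $N_{S_1,\dots,S_k}(y,V)\subseteq B$. The $d$-joining of $B_1,\dots,B_d\subseteq\mathbb{Z}^{d-1}$ is the set $$\{(n_1,\dots,n_d)\in\mathbb{Z}^d : (n_1,\dots,n_{i-1},n_{i+1},\dots,n_d)\in B_i\ \text{for every } i\in\{1,\dots,d\}\}.$$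 The set of directional dynamical cubes of a $\mathbb{Z}^d$-system $(X,T_1,\dots,T_d)$ is $$\mathbf{Q}_{T_1,\dots,T_d}(X)=\overline{\{(T_1^{n_1\varepsilon_1}\cdots T_d^{n_d\varepsilon_d}x)_{\varepsilon\in\{0,1\}^d} : x\in X,\ (n_1,\dots,n_d)\in\mathbb{Z}^d\}}\subseteq X^{2^d},$$ and the system has the unique closing parallelepiped property if any two points of $\mathbf{Q}_{T_1,\dots,T_d}(X)$ that have $2^d-1$ coordinates in common are equal. Let $(X,T_1,\dots,T_d)$ be a minimal distal $\mathbb{Z}^d$-system. Then $(X,T_1,\dots,T_d)$ has the unique closing parallelepiped property if and only if for every $x\in X$ and every open neighborhood $U$ of $x$, the set $N_{T_1,\dots,T_d}(x,U)$ contains the $d$-joining of some sets $B_1,\dots,B_d\subseteq\mathbb{Z}^{d-1}$, each of which is a set of return times of a minimal distal $\mathbb{Z}^{d-1}$-system. -/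

import Mathlib

open Set

universe u

/-- A `ℤ^d`-system on `X`: `d` pairwise commuting homeomorphisms `T_1, …, T_d` of `X`.
(`X` is a compact metric space wherever this is used; the group law on `X ≃ₜ X` is
composition.) -/
structure ZdSystem (d : ℕ) (X : Type u) [TopologicalSpace X] where
  T : Fin d → X ≃ₜ X
  comm : ∀ i j, T i * T j = T j * T i

namespace ZdSystem

section Topological

variable {d : ℕ} {X : Type u} [TopologicalSpace X] (S : ZdSystem d X)

/-- The group `⟨T_1, …, T_d⟩` of homeomorphisms generated by the transformations. -/
def group : Subgroup (X ≃ₜ X) := Subgroup.closure (range S.T)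

/-- The homeomorphism `T_1^{n_1} ⋯ T_d^{n_d}`. -/
def pow (n : Fin d → ℤ) : X ≃ₜ X := (List.ofFn fun i => S.T i ^ n i).prod

/-- The orbit of `x` under `⟨T_1, …, T_d⟩`. -/
def orbit (x : X) : Set X := {y | ∃ g ∈ S.group, g x = y}

/-- Minimality: the orbit of every point is dense. -/
def IsMinimal : Prop := ∀ x : X, Dense (S.orbit x)

/-- The set `Q_{T_1,…,T_d}(X)` of directional dynamical cubes: the closure in `X^{{0,1}^d}` of the
points `(T_1^{n_1 ε_1} ⋯ T_d^{n_d ε_d} x)_ε`, where `x ∈ X` and `n ∈ ℤ^d`.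
A vertex `ε ∈ {0,1}^d` is a function `Fin d → Bool`. -/
def cubes : Set ((Fin d → Bool) → X) :=
  closure {c | ∃ (x : X) (n : Fin d → ℤ),
    c = fun ε => S.pow (fun i => if ε i then n i else 0) x}

/-- The unique closing parallelepiped property: two directional cubes that have `2^d - 1`
coordinates in common (all but possibly the one at `ε₀`) are equal. -/
def UniqueClosingParallelepiped : Prop :=
  ∀ x ∈ S.cubes, ∀ y ∈ S.cubes, ∀ ε₀ : Fin d → Bool, (∀ ε, ε ≠ ε₀ → x ε = y ε) → x = y

/-- `N_{T_1,…,T_d}(x,U)`, the set of `n ∈ ℤ^d` with `T_1^{n_1} ⋯ T_d^{n_d} x ∈ U`. -/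
def returnTimes (x : X) (U : Set X) : Set (Fin d → ℤ) := {n | S.pow n x ∈ U}

end Topological

/-- Distality: `inf_{g ∈ G} dist (g x) (g y) > 0` for all `x ≠ y`, where `G = ⟨T_1, …, T_d⟩`. -/
def IsDistal {d : ℕ} {X : Type u} [MetricSpace X] (S : ZdSystem d X) : Prop :=
  ∀ x y : X, x ≠ y → 0 < ⨅ g : S.group, dist ((g : X ≃ₜ X) x) ((g : X ≃ₜ X) y)

end ZdSystem

/-- `B ⊆ ℤ^d` is a set of return times of a minimal distal `ℤ^d`-system: there are a minimal distal
`ℤ^d`-system on a compact metric space `Y`, a point `y` and an open neighbourhood `U` of `y` with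
`N(y,U) ⊆ B`. -/
def IsMinimalDistalReturnTimeSet {d : ℕ} (B : Set (Fin d → ℤ)) : Prop :=
  ∃ (Y : Type u) (_ : MetricSpace Y) (_ : CompactSpace Y) (S : ZdSystem d Y),
    S.IsMinimal ∧ S.IsDistal ∧
      ∃ (y : Y) (U : Set Y), IsOpen U ∧ y ∈ U ∧ S.returnTimes y U ⊆ B

/-- The `d`-joining of `B_1, …, B_d ⊆ ℤ^{d-1}`, with `d = m + 1`: the set of `n ∈ ℤ^d` such that
for every `i` the vector `n` with its `i`-th coordinate deleted belongs to `B_i`. -/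
def setJoining {m : ℕ} (B : Fin (m + 1) → Set (Fin m → ℤ)) : Set (Fin (m + 1) → ℤ) :=
  {n | ∀ i : Fin (m + 1), (fun k : Fin m => n (i.succAbove k)) ∈ B i}

/-! If cubes close uniquely, compactness gives `δ` such that a cube whose other vertices are
`δ`-close to `x` has its all-true vertex in `U`. Every other vertex lies on some lower face, and the
motion of that face is a distal `ℤ^m`-system; the `B_i` are the return times of these systems to a
`δ`-ball. Distal orbit closures are minimal (`mem_closure_orbit_symm`), so each face system may be
restricted to one.

Conversely, suppose closing fails. Minimality of cube orbit closures yields a cube equal to `x`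
except at one vertex `ε₀`, which stays `δ`-far from `x` along the whole orbit
(`exists_mem_cubesAt_of_ne`). Given `B_i` realised at `y_i ∈ Y_i`, let `T_i` act trivially on `Y_i`
and form the product with `X`. The cube lifts to one equal to `(x, y)` off `ε₀`
(`exists_lift_mem_cubesAt`). Edges of direction `i` are constant in `Y_i`, so the vertex at `ε₀`
also has `Y`-part `y`, while its `X`-part is far from `x`. Approximating it along the orbit of `(x,
y)` gives `n` in the joining with `T^n x` far from `x`. -/

/-! ### Distal actions and minimality of their orbit closures -/

/-- A semigroup `Γ` acting (through `φ`) by continuous maps on a space `Z`, such that distinct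
points are never proximal. -/
structure IsDistalAction {Γ Z : Type*} [Add Γ] [TopologicalSpace Z] (φ : Γ → Z → Z) : Prop where
  continuous : ∀ g, Continuous (φ g)
  map_add : ∀ g h z, φ (g + h) z = φ g (φ h z)
  distal : ∀ x y z, (z, z) ∈ closure (range fun g => (φ g x, φ g y)) → x = y

namespace IsDistalAction

section

variable {Γ Γ' Z : Type*} [Add Γ] [Add Γ'] [TopologicalSpace Z] {φ : Γ → Z → Z}

theorem comap (h : IsDistalAction φ) (f : Γ' → Γ) (hf : ∀ a b, f (a + b) = f a + f b) :
    IsDistalAction fun g => φ (f g) where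
  continuous g := h.continuous _
  map_add a b z := by rw [hf, h.map_add]
  distal x y z hz := by
    refine h.distal x y z (closure_mono ?_ hz)
    rintro _ ⟨g, rfl⟩
    exact ⟨f g, rfl⟩

theorem pi {ι : Type*} {Z : ι → Type*} [∀ i, TopologicalSpace (Z i)] {φ : ∀ i, Γ → Z i → Z i}
    (h : ∀ i, IsDistalAction (φ i)) :
    IsDistalAction fun (g : Γ) (z : ∀ i, Z i) i => φ i g (z i) where
  continuous g := continuous_pi fun i => ((h i).continuous g).comp (continuous_apply i)
  map_add a b z := funext fun i => (h i).map_add a b (z i)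
  distal x y z hz := by
    funext i
    refine (h i).distal (x i) (y i) (z i) ?_
    have hc : Continuous fun p : (∀ i, Z i) × (∀ i, Z i) => (p.1 i, p.2 i) := by fun_prop
    refine closure_mono ?_ (image_closure_subset_closure_image hc ⟨_, hz, rfl⟩)
    rintro _ ⟨_, ⟨g, rfl⟩, rfl⟩
    exact ⟨g, rfl⟩

theorem prod {Z' : Type*} [TopologicalSpace Z'] {φ' : Γ → Z' → Z'} (h : IsDistalAction φ)
    (h' : IsDistalAction φ') :
    IsDistalAction fun (g : Γ) (z : Z × Z') => (φ g z.1, φ' g z.2) where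
  continuous g := ((h.continuous g).comp continuous_fst).prodMk
    ((h'.continuous g).comp continuous_snd)
  map_add a b z := Prod.ext (h.map_add a b z.1) (h'.map_add a b z.2)
  distal x y z hz := by
    refine Prod.ext (h.distal x.1 y.1 z.1 ?_) (h'.distal x.2 y.2 z.2 ?_)
    · have hc : Continuous fun p : (Z × Z') × (Z × Z') => (p.1.1, p.2.1) := by fun_prop
      refine closure_mono ?_ (image_closure_subset_closure_image hc ⟨_, hz, rfl⟩)
      rintro _ ⟨_, ⟨g, rfl⟩, rfl⟩
      exact ⟨g, rfl⟩
    · have hc : Continuous fun p : (Z × Z') × (Z × Z') => (p.1.2, p.2.2) := by fun_prop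
      refine closure_mono ?_ (image_closure_subset_closure_image hc ⟨_, hz, rfl⟩)
      rintro _ ⟨_, ⟨g, rfl⟩, rfl⟩
      exact ⟨g, rfl⟩

theorem map_mem_closure_orbit (h : IsDistalAction φ) {x y : Z}
    (hy : y ∈ closure (range fun g => φ g x)) (g : Γ) :
    φ g y ∈ closure (range fun g => φ g x) := by
  refine closure_mono ?_ (image_closure_subset_closure_image (h.continuous g) ⟨y, hy, rfl⟩)
  rintro _ ⟨_, ⟨k, rfl⟩, rfl⟩
  exact ⟨g + k, h.map_add _ _ _⟩

theorem mem_closure_orbit_trans (h : IsDistalAction φ) {x y z : Z}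
    (hy : y ∈ closure (range fun g => φ g x)) (hz : z ∈ closure (range fun g => φ g y)) :
    z ∈ closure (range fun g => φ g x) :=
  closure_minimal (range_subset_iff.2 (h.map_mem_closure_orbit hy)) isClosed_closure hz

end

/-- The points of the closure of a set `s` have preimages in the closure of a set mapped
onto `s`. -/
theorem exists_mem_closure_range_of_mem_closure_range {Γ Z Z' : Type*} [TopologicalSpace Z]
    [CompactSpace Z] [TopologicalSpace Z'] [T2Space Z'] {f : Γ → Z} {p : Z → Z'}
    (hp : Continuous p) {y : Z'} (hy : y ∈ closure (range fun g => p (f g))) :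
    ∃ z ∈ closure (range f), p z = y := by
  have hc : IsClosed (p '' closure (range f)) := (isClosed_closure.isCompact.image hp).isClosed
  refine closure_minimal ?_ hc hy
  rintro _ ⟨g, rfl⟩
  exact ⟨f g, subset_closure ⟨g, rfl⟩, rfl⟩

/-- Orbit closures of a distal action are minimal. -/
theorem mem_closure_orbit_symm {Γ Z : Type*} [Add Γ] [TopologicalSpace Z] [CompactSpace Z]
    [T2Space Z] {φ : Γ → Z → Z} (h : IsDistalAction φ) {x y : Z}
    (hy : y ∈ closure (range fun g => φ g x)) : x ∈ closure (range fun g => φ g y) := by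
  -- `E` is the Ellis semigroup; composition is continuous in its left factor only.
  let E : Set (Z → Z) := closure (range φ)
  obtain ⟨p, hpE, hpx⟩ := exists_mem_closure_range_of_mem_closure_range
    (f := φ) (p := fun q : Z → Z => q x) (continuous_apply x) hy
  have hright : ∀ r : Z → Z, Continuous fun q : Z → Z => q ∘ r := fun r =>
    continuous_pi fun z => continuous_apply (r z)
  have hleft : ∀ g, ∀ q ∈ E, φ g ∘ q ∈ E := by
    intro g q hq
    have hc : Continuous fun q : Z → Z => φ g ∘ q :=
      continuous_pi fun z => (h.continuous g).comp (continuous_apply z)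
    refine closure_mono ?_ (image_closure_subset_closure_image hc ⟨q, hq, rfl⟩)
    rintro _ ⟨_, ⟨k, rfl⟩, rfl⟩
    exact ⟨g + k, funext fun z => h.map_add _ _ _⟩
  have hmul : ∀ q ∈ E, ∀ r ∈ E, q ∘ r ∈ E := by
    intro q hq r hr
    have : (fun q : Z → Z => q ∘ r) '' range φ ⊆ E := by
      rintro _ ⟨_, ⟨k, rfl⟩, rfl⟩
      exact hleft k r hr
    exact closure_minimal this isClosed_closure
      (image_closure_subset_closure_image (hright r) ⟨q, hq, rfl⟩)
  let _ : Semigroup (Z → Z) :=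
    { mul := fun q r => q ∘ r
      mul_assoc := fun _ _ _ => rfl }
  -- The Ellis–Numakura lemma in the closed left ideal `E ∘ p` gives an idempotent `q ∘ p`.
  obtain ⟨_, ⟨q, hq, rfl⟩, hidem⟩ := exists_idempotent_in_compact_subsemigroup
    (M := Z → Z) hright ((fun q : Z → Z => q ∘ p) '' E) ⟨_, p, hpE, rfl⟩
    (isClosed_closure.isCompact.image (hright p)) (by
      rintro _ ⟨a, ha, rfl⟩ _ ⟨b, hb, rfl⟩
      exact ⟨a ∘ p ∘ b, hmul _ ha _ (hmul _ hpE _ hb), rfl⟩)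
  -- The idempotent sends `x` and its image to the same point, so the two are proximal, hence equal.
  have hux : q (p x) = x := by
    refine h.distal _ _ (q (p x)) ?_
    have hc : Continuous fun r : Z → Z => (r (q (p x)), r x) :=
      (continuous_apply _).prodMk (continuous_apply _)
    have hmem : ((q ∘ p) (q (p x)), (q ∘ p) x) ∈ closure _ :=
      image_closure_subset_closure_image hc ⟨q ∘ p, hmul _ hq _ hpE, rfl⟩
    have e : ((q ∘ p) (q (p x)), (q ∘ p) x) = (q (p x), q (p x)) :=
      Prod.ext (congrFun hidem x) rfl
    refine closure_mono ?_ (e ▸ hmem)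
    rintro _ ⟨_, ⟨g, rfl⟩, rfl⟩
    exact ⟨g, rfl⟩
  have hqy : q y = x := by rw [← hpx]; exact hux
  have hmem : q y ∈ closure _ :=
    image_closure_subset_closure_image (continuous_apply y) ⟨q, hq, rfl⟩
  rw [hqy] at hmem
  refine closure_mono ?_ hmem
  rintro _ ⟨_, ⟨g, rfl⟩, rfl⟩
  exact ⟨g, rfl⟩

end IsDistalAction

/-! ### Systems as actions of `ℤ^d`, and distality along powers -/

namespace ZdSystem

section Powers

variable {d : ℕ} {X : Type*} [TopologicalSpace X] (S : ZdSystem d X)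

theorem _root_.List.prod_ofFn_zpow_add {G : Type*} [Group G] {d : ℕ} (T : Fin d → G)
    (h : ∀ i j, Commute (T i) (T j)) (n k : Fin d → ℤ) :
    (List.ofFn fun i => T i ^ (n i + k i)).prod =
      (List.ofFn fun i => T i ^ n i).prod * (List.ofFn fun i => T i ^ k i).prod := by
  induction d with
  | zero => simp
  | succ d ih =>
    have hc : Commute (T 0 ^ k 0) (List.ofFn fun i : Fin d => T i.succ ^ n i.succ).prod := by
      refine Commute.list_prod_right _ _ fun g hg => ?_
      obtain ⟨i, rfl⟩ := (List.mem_ofFn' _ _).1 hg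
      exact (h _ _).zpow_zpow _ _
    simp only [List.ofFn_succ, List.prod_cons]
    rw [ih (fun i => T i.succ) (fun i j => h _ _) (fun i => n i.succ) (fun i => k i.succ),
      zpow_add, mul_assoc, mul_assoc, ← mul_assoc (T 0 ^ k 0), hc.eq, mul_assoc]

theorem _root_.List.prod_ofFn_zpow_single {G : Type*} [Group G] {d : ℕ} (T : Fin d → G)
    (j : Fin d) : (List.ofFn fun i => T i ^ (Pi.single j 1 : Fin d → ℤ) i).prod = T j := by
  induction d with
  | zero => exact j.elim0
  | succ d ih =>
    rw [List.ofFn_succ, List.prod_cons]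
    refine Fin.cases ?_ (fun j => ?_) j
    · simp
    · have := ih (fun i => T i.succ) j
      simpa [Pi.single_apply, Fin.succ_inj, (Fin.succ_ne_zero j).symm] using this

theorem pow_zero : S.pow 0 = 1 := by simp [pow]

theorem pow_zero_apply (x : X) : S.pow 0 x = x := by
  rw [pow_zero]; rfl

theorem pow_add (n k : Fin d → ℤ) : S.pow (n + k) = S.pow n * S.pow k :=
  List.prod_ofFn_zpow_add S.T (fun i j => S.comm i j) n k

theorem pow_add_apply (n k : Fin d → ℤ) (x : X) : S.pow (n + k) x = S.pow n (S.pow k x) := by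
  rw [pow_add]; rfl

theorem pow_mem_group (n : Fin d → ℤ) : S.pow n ∈ S.group := by
  refine Subgroup.list_prod_mem _ fun g hg => ?_
  obtain ⟨i, rfl⟩ := (List.mem_ofFn' _ _).1 hg
  exact Subgroup.zpow_mem _ (Subgroup.subset_closure (mem_range_self i)) _

theorem exists_pow_eq_of_mem_group {g : X ≃ₜ X} (hg : g ∈ S.group) : ∃ n, S.pow n = g := by
  induction hg using Subgroup.closure_induction with
  | mem g hg =>
    obtain ⟨i, rfl⟩ := hg
    exact ⟨Pi.single i 1, List.prod_ofFn_zpow_single S.T i⟩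
  | one => exact ⟨0, S.pow_zero⟩
  | mul g h _ _ hg hh =>
    obtain ⟨n, rfl⟩ := hg
    obtain ⟨k, rfl⟩ := hh
    exact ⟨n + k, S.pow_add n k⟩
  | inv g _ hg =>
    obtain ⟨n, rfl⟩ := hg
    refine ⟨-n, eq_inv_of_mul_eq_one_left ?_⟩
    rw [← pow_add, neg_add_cancel, pow_zero]

theorem orbit_eq_range (x : X) : S.orbit x = range fun n => S.pow n x := by
  ext y
  constructor
  · rintro ⟨g, hg, rfl⟩
    obtain ⟨n, rfl⟩ := S.exists_pow_eq_of_mem_group hg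
    exact ⟨n, rfl⟩
  · rintro ⟨n, rfl⟩
    exact ⟨_, S.pow_mem_group n, rfl⟩

/-- The system attached to an action of `ℤ^d` by homeomorphisms. -/
def ofAction (ψ : Multiplicative (Fin d → ℤ) →* (X ≃ₜ X)) : ZdSystem d X where
  T i := ψ (Multiplicative.ofAdd (Pi.single i 1))
  comm i j := by rw [← map_mul, mul_comm, map_mul]

theorem pow_ofAction (ψ : Multiplicative (Fin d → ℤ) →* (X ≃ₜ X)) (n : Fin d → ℤ) :
    (ofAction ψ).pow n = ψ (Multiplicative.ofAdd n) := by
  have hn : (List.ofFn fun i => Multiplicative.ofAdd (Pi.single i (1 : ℤ) : Fin d → ℤ) ^ n i).prod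
      = Multiplicative.ofAdd n := by
    rw [List.prod_ofFn, ← Finset.univ_sum_single n, ofAdd_sum]
    refine Finset.prod_congr rfl fun i _ => ?_
    rw [← ofAdd_zsmul, ← Pi.single_smul]
    simp
  rw [← hn, map_list_prod, List.map_ofFn]
  simp only [pow, ofAction, Function.comp_def, map_zpow]

end Powers

section Distal

variable {d : ℕ} {X : Type*} [MetricSpace X] {S : ZdSystem d X}

theorem le_dist_of_mem_closure {Γ : Type*} {a b : Γ → X} {δ : ℝ} (h : ∀ g, δ ≤ dist (a g) (b g))
    {p : X × X} (hp : p ∈ closure (range fun g => (a g, b g))) : δ ≤ dist p.1 p.2 := by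
  have hc : IsClosed {p : X × X | δ ≤ dist p.1 p.2} := isClosed_le (by fun_prop) (by fun_prop)
  have hs : (range fun g => (a g, b g)) ⊆ {p : X × X | δ ≤ dist p.1 p.2} := by
    rintro _ ⟨g, rfl⟩
    exact h g
  exact closure_minimal hs hc hp

theorem IsDistal.exists_le_dist (h : S.IsDistal) {x y : X} (hxy : x ≠ y) :
    ∃ δ > 0, ∀ n, δ ≤ dist (S.pow n x) (S.pow n y) :=
  ⟨_, h x y hxy, fun n => ciInf_le ⟨0, by rintro _ ⟨g, rfl⟩; exact dist_nonneg⟩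
    (⟨S.pow n, S.pow_mem_group n⟩ : S.group)⟩

theorem isDistal_of_forall_exists
    (h : ∀ x y : X, x ≠ y → ∃ δ > 0, ∀ n, δ ≤ dist (S.pow n x) (S.pow n y)) : S.IsDistal := by
  intro x y hxy
  obtain ⟨δ, hδ, hle⟩ := h x y hxy
  refine hδ.trans_le (le_ciInf ?_)
  rintro ⟨g, hg⟩
  obtain ⟨n, rfl⟩ := S.exists_pow_eq_of_mem_group hg
  exact hle n

theorem IsDistal.isDistalAction (h : S.IsDistal) : IsDistalAction fun n x => S.pow n x where
  continuous n := (S.pow n).continuous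
  map_add := S.pow_add_apply
  distal x y z hz := by
    by_contra hxy
    obtain ⟨δ, hδ, hle⟩ := h.exists_le_dist hxy
    have := le_dist_of_mem_closure hle hz
    rw [dist_self] at this
    exact this.not_gt hδ

end Distal

end ZdSystem

/-! ### Orbit closures as minimal subsystems -/

namespace ZdSystem

section Subsystem

variable {d : ℕ} {Z : Type u} [MetricSpace Z]

theorem pow_mem_closure_orbit_iff {S : ZdSystem d Z} (hS : S.IsDistal) (z : Z) (n : Fin d → ℤ)
    (x : Z) : x ∈ closure (range fun k => S.pow k z) ↔
      S.pow n x ∈ closure (range fun k => S.pow k z) := by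
  refine ⟨fun h => hS.isDistalAction.map_mem_closure_orbit h n, fun h => ?_⟩
  have := hS.isDistalAction.map_mem_closure_orbit h (-n)
  simpa only [← pow_add_apply, neg_add_cancel, pow_zero_apply] using this

/-- The orbit closure of a point of a distal system, as a system. -/
def orbitClosure (S : ZdSystem d Z) (hS : S.IsDistal) (z : Z) :
    ZdSystem d {x // x ∈ closure (range fun k => S.pow k z)} :=
  ofAction
    { toFun := fun n => (S.pow n.toAdd).subtype (pow_mem_closure_orbit_iff hS z n.toAdd)
      map_one' := by
        ext x
        exact congrArg (fun g : Z ≃ₜ Z => g x) S.pow_zero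
      map_mul' := fun n k => by
        ext x
        exact S.pow_add_apply _ _ _ }

theorem coe_pow_orbitClosure (S : ZdSystem d Z) (hS : S.IsDistal) (z : Z) (n : Fin d → ℤ)
    (x : {x // x ∈ closure (range fun k => S.pow k z)}) :
    ((S.orbitClosure hS z).pow n x : Z) = S.pow n x := by
  rw [orbitClosure, pow_ofAction]
  rfl

theorem isMinimal_orbitClosure [CompactSpace Z] (S : ZdSystem d Z) (hS : S.IsDistal) (z : Z) :
    (S.orbitClosure hS z).IsMinimal := by
  intro x y
  rw [orbit_eq_range, closure_subtype, ← range_comp]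
  have hx := hS.isDistalAction.mem_closure_orbit_symm x.2
  simpa only [Function.comp_def, coe_pow_orbitClosure] using
    hS.isDistalAction.mem_closure_orbit_trans hx y.2

theorem isDistal_orbitClosure (S : ZdSystem d Z) (hS : S.IsDistal) (z : Z) :
    (S.orbitClosure hS z).IsDistal := by
  refine isDistal_of_forall_exists fun x y hxy => ?_
  obtain ⟨δ, hδ, h⟩ := hS.exists_le_dist (Subtype.coe_injective.ne hxy)
  refine ⟨δ, hδ, fun n => ?_⟩
  rw [Subtype.dist_eq, coe_pow_orbitClosure, coe_pow_orbitClosure]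
  exact h n

/-- Minimality is free: return times of `z` are unchanged on restricting to its orbit closure. -/
theorem IsDistal.isMinimalDistalReturnTimeSet [CompactSpace Z] {S : ZdSystem d Z}
    (hS : S.IsDistal) {z : Z} {U : Set Z} (hU : IsOpen U) (hz : z ∈ U) :
    IsMinimalDistalReturnTimeSet.{u} (S.returnTimes z U) := by
  refine ⟨_, inferInstance, isCompact_iff_compactSpace.1 isClosed_closure.isCompact,
    S.orbitClosure hS z, S.isMinimal_orbitClosure hS z, S.isDistal_orbitClosure hS z,
    ⟨z, subset_closure ⟨0, S.pow_zero_apply z⟩⟩, Subtype.val ⁻¹' U,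
    hU.preimage continuous_subtype_val, hz, fun n hn => ?_⟩
  change ((S.orbitClosure hS z).pow n _ : Z) ∈ U at hn
  rwa [coe_pow_orbitClosure] at hn

end Subsystem

/-! ### Face systems and the forward implication -/

section Faces

variable {m : ℕ} {X : Type u}

/-- The vector `n`, extended by `0` at the coordinate `i` and restricted to the support of `η`. -/
def faceVector (i : Fin (m + 1)) (η : Fin m → Bool) (n : Fin m → ℤ) : Fin (m + 1) → ℤ :=
  i.insertNth 0 fun k => if η k then n k else 0

theorem faceVector_zero (i : Fin (m + 1)) (η : Fin m → Bool) : faceVector i η 0 = 0 := by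
  funext j
  refine Fin.succAboveCases i ?_ (fun k => ?_) j <;> simp [faceVector]

theorem faceVector_add (i : Fin (m + 1)) (η : Fin m → Bool) (n k : Fin m → ℤ) :
    faceVector i η (n + k) = faceVector i η n + faceVector i η k := by
  funext j
  refine Fin.succAboveCases i ?_ (fun l => ?_) j
  · simp [faceVector]
  · by_cases h : η l <;> simp [faceVector, h]

theorem faceVector_comp_succAbove (i : Fin (m + 1)) (ε : Fin (m + 1) → Bool) (hε : ε i = false)
    (n : Fin (m + 1) → ℤ) :
    faceVector i (fun k => ε (i.succAbove k)) (fun k => n (i.succAbove k)) =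
      fun j => if ε j then n j else 0 := by
  funext j
  refine Fin.succAboveCases i ?_ (fun l => ?_) j <;> simp [faceVector, hε]

/-- The action of the transformations other than `T_i` on the vertices of the lower face
`ε_i = 0` of a cube, each of them acting on the corresponding upper face. -/
def faceSystem [TopologicalSpace X] (S : ZdSystem (m + 1) X) (i : Fin (m + 1)) :
    ZdSystem m ((Fin m → Bool) → X) :=
  ofAction
    { toFun := fun n => Homeomorph.piCongrRight fun η => S.pow (faceVector i η n.toAdd)
      map_one' := by
        ext x η
        change S.pow (faceVector i η 0) (x η) = x η
        rw [faceVector_zero, pow_zero_apply]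
      map_mul' := fun n k => by
        ext x η
        change S.pow (faceVector i η (n.toAdd + k.toAdd)) (x η) = _
        rw [faceVector_add, pow_add_apply]
        rfl }

theorem pow_faceSystem_apply [TopologicalSpace X] (S : ZdSystem (m + 1) X) (i : Fin (m + 1))
    (n : Fin m → ℤ) (x : (Fin m → Bool) → X) (η : Fin m → Bool) :
    (S.faceSystem i).pow n x η = S.pow (faceVector i η n) (x η) := by
  rw [faceSystem, pow_ofAction]
  rfl

theorem isDistal_faceSystem [MetricSpace X] {S : ZdSystem (m + 1) X} (hS : S.IsDistal)
    (i : Fin (m + 1)) : (S.faceSystem i).IsDistal := by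
  refine isDistal_of_forall_exists fun x y hxy => ?_
  obtain ⟨η, hη⟩ := Function.ne_iff.1 hxy
  obtain ⟨δ, hδ, h⟩ := hS.exists_le_dist hη
  refine ⟨δ, hδ, fun n => (h (faceVector i η n)).trans ?_⟩
  rw [← pow_faceSystem_apply, ← pow_faceSystem_apply]
  exact dist_le_pi_dist _ _ η

end Faces

section UniqueClosing

variable {m : ℕ} {X : Type u}

theorem const_mem_cubes {d : ℕ} [TopologicalSpace X] (S : ZdSystem d X) (x : X) :
    (fun _ => x) ∈ S.cubes := by
  refine subset_closure ⟨x, 0, funext fun ε => ?_⟩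
  have : (fun i => if ε i then (0 : Fin d → ℤ) i else 0) = 0 := by
    funext i
    simp
  rw [this, pow_zero_apply]

/-- Under the unique closing property, a cube whose vertices other than `ε₀` are close to `x`
has its vertex `ε₀` close to `x`. -/
theorem UniqueClosingParallelepiped.exists_forall_dist_lt {d : ℕ} [MetricSpace X] [CompactSpace X]
    {S : ZdSystem d X} (hS : S.UniqueClosingParallelepiped) (ε₀ : Fin d → Bool) {x : X} {U : Set X}
    (hU : IsOpen U) (hx : x ∈ U) :
    ∃ δ > 0, ∀ c ∈ S.cubes, (∀ ε, ε ≠ ε₀ → dist (c ε) x < δ) → c ε₀ ∈ U := by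
  -- `ρ` forgets the vertex `ε₀`. Unique closing keeps the constant `x` out of the compact image of
  -- the cubes with `c ε₀ ∉ U`; `δ` is the radius of a ball missing it.
  let ρ : ((Fin d → Bool) → X) → (Fin d → Bool) → X := fun c => Function.update c ε₀ x
  have hρ : Continuous ρ := continuous_id.update ε₀ continuous_const
  have hK : IsClosed (S.cubes ∩ {c | c ε₀ ∈ Uᶜ}) :=
    isClosed_closure.inter (hU.isClosed_compl.preimage (continuous_apply ε₀))
  have hK' : IsClosed (ρ '' (S.cubes ∩ {c | c ε₀ ∈ Uᶜ})) := (hK.isCompact.image hρ).isClosed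
  have hxK : (fun _ => x) ∈ (ρ '' (S.cubes ∩ {c | c ε₀ ∈ Uᶜ}))ᶜ := by
    rintro ⟨c, ⟨hc, hcU⟩, hcx⟩
    have := hS c hc _ (S.const_mem_cubes x) ε₀ fun ε hε => by
      rw [← congrFun hcx ε]
      exact (Function.update_of_ne hε _ _).symm
    rw [this] at hcU
    exact hcU hx
  obtain ⟨δ, hδ, hball⟩ := Metric.isOpen_iff.1 hK'.isOpen_compl _ hxK
  refine ⟨δ, hδ, fun c hc hcδ => ?_⟩
  by_contra hcU
  refine hball (?_ : ρ c ∈ _) ⟨c, ⟨hc, hcU⟩, rfl⟩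
  rw [Metric.mem_ball, dist_pi_lt_iff hδ]
  intro ε
  by_cases hε : ε = ε₀
  · subst hε
    simpa [ρ] using hδ
  · simpa [ρ, hε] using hcδ ε hε

theorem UniqueClosingParallelepiped.exists_setJoining_subset [MetricSpace X] [CompactSpace X]
    {S : ZdSystem (m + 1) X} (hS : S.UniqueClosingParallelepiped) (hdist : S.IsDistal) {x : X}
    {U : Set X} (hU : IsOpen U) (hx : x ∈ U) :
    ∃ B : Fin (m + 1) → Set (Fin m → ℤ),
      (∀ i, IsMinimalDistalReturnTimeSet.{u} (B i)) ∧ setJoining B ⊆ S.returnTimes x U := by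
  obtain ⟨δ, hδ, h⟩ := hS.exists_forall_dist_lt (fun _ => true) hU hx
  refine ⟨fun i => (S.faceSystem i).returnTimes (fun _ => x) (Metric.ball (fun _ => x) δ),
    fun i => (isDistal_faceSystem hdist i).isMinimalDistalReturnTimeSet Metric.isOpen_ball
      (Metric.mem_ball_self hδ), fun n hn => ?_⟩
  have := h _ (subset_closure ⟨x, n, rfl⟩) fun ε hε => ?_
  · simpa [returnTimes] using this
  · obtain ⟨i, hi⟩ := Function.ne_iff.1 hε
    have hi' : ε i = false := by simpa using hi
    have hni : (S.faceSystem i).pow (fun k => n (i.succAbove k)) (fun _ => x) ∈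
      Metric.ball (fun _ => x) δ := hn i
    rw [Metric.mem_ball, dist_pi_lt_iff hδ] at hni
    have := hni fun k => ε (i.succAbove k)
    rwa [pow_faceSystem_apply, faceVector_comp_succAbove i ε hi'] at this

end UniqueClosing

end ZdSystem

/-! ### The cube group and motions that preserve edges of one direction -/

section CubeAction

variable {d : ℕ} {Z : Type*} (φ : (Fin d → ℤ) → Z → Z)

/-- The action on `Z^{{0,1}^d}` generated by the diagonal transformations (first component) and
the transformations of the upper faces (second component). -/
def cubeAction (g : (Fin d → ℤ) × (Fin d → ℤ)) (c : (Fin d → Bool) → Z) : (Fin d → Bool) → Z :=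
  fun ε => φ (g.1 + fun i => if ε i then g.2 i else 0) (c ε)

/-- The part of `cubeAction` that does not involve the face transformation in direction `j`. -/
def cubeActionErase (j : Fin d) (g : (Fin d → ℤ) × (Fin d → ℤ)) (c : (Fin d → Bool) → Z) :
    (Fin d → Bool) → Z :=
  cubeAction φ (g.1, Function.update g.2 j 0) c

/-- The directional cubes of the orbit closure of `w`. -/
def cubesAt [TopologicalSpace Z] (w : Z) : Set ((Fin d → Bool) → Z) :=
  closure (range fun g => cubeAction φ g fun _ => w)

variable {φ}

theorem IsDistalAction.cubeAction [TopologicalSpace Z] (h : IsDistalAction φ) :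
    IsDistalAction (cubeAction φ) :=
  IsDistalAction.pi fun ε => h.comap
    (fun g : (Fin d → ℤ) × (Fin d → ℤ) => g.1 + fun i => if ε i then g.2 i else 0) fun a b => by
      funext i
      by_cases hi : ε i <;> simp [hi]
      ring

theorem IsDistalAction.cubeActionErase [TopologicalSpace Z] (h : IsDistalAction φ) (j : Fin d) :
    IsDistalAction (cubeActionErase φ j) :=
  h.cubeAction.comap (fun g : (Fin d → ℤ) × (Fin d → ℤ) => (g.1, Function.update g.2 j 0)) fun a b => by
    refine Prod.ext rfl (funext fun i => ?_)
    by_cases hi : i = j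
    · subst hi
      simp
    · simp [hi]

/-- `cubeActionErase φ j` acts in the same way on the two ends of an edge of direction `j`. -/
theorem cubeActionErase_apply_update (j : Fin d) (b : Bool) (g : (Fin d → ℤ) × (Fin d → ℤ))
    (c : (Fin d → Bool) → Z) (ε : Fin d → Bool) :
    cubeActionErase φ j g c (Function.update ε j b) =
      φ (g.1 + fun i => if ε i then Function.update g.2 j 0 i else 0)
        (c (Function.update ε j b)) := by
  rw [cubeActionErase, cubeAction]
  congr 2
  funext i
  by_cases hi : i = j
  · subst hi
    simp
  · simp [hi]

theorem mem_cubesAt_of_mem_closure_cubeActionErase [TopologicalSpace Z] (h : IsDistalAction φ)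
    {w : Z} {j : Fin d} {c c' : (Fin d → Bool) → Z} (hc : c ∈ cubesAt φ w)
    (hc' : c' ∈ closure (range fun g => cubeActionErase φ j g c)) : c' ∈ cubesAt φ w := by
  refine h.cubeAction.mem_closure_orbit_trans hc (closure_mono ?_ hc')
  rintro _ ⟨g, rfl⟩
  exact ⟨_, rfl⟩

/-- A face of a cube in `cubesAt φ w` can be moved to the constant `w` without using the face
transformation in the direction transversal to the face. -/
theorem exists_mem_closure_cubeActionErase [TopologicalSpace Z] [CompactSpace Z] [T2Space Z]
    (h : IsDistalAction φ) {w : Z} {c : (Fin d → Bool) → Z} (hc : c ∈ cubesAt φ w) (j : Fin d)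
    (b : Bool) :
    ∃ c' ∈ closure (range fun g => cubeActionErase φ j g c), ∀ ε, ε j = b → c' ε = w := by
  -- `ρ` copies the face `ε j = b` onto the opposite one and commutes with the erased action.
  let ρ : ((Fin d → Bool) → Z) → (Fin d → Bool) → Z := fun c ε => c (Function.update ε j b)
  have hρ : Continuous ρ := continuous_pi fun ε => continuous_apply _
  have hcomm : ∀ g c, ρ (cubeActionErase φ j g c) = cubeActionErase φ j g (ρ c) := by
    intro g c
    funext ε
    exact cubeActionErase_apply_update j b g c ε
  have h1 : ρ c ∈ closure (range fun g => cubeActionErase φ j g fun _ => w) := by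
    refine closure_mono ?_ (image_closure_subset_closure_image hρ ⟨c, hc, rfl⟩)
    rintro _ ⟨_, ⟨g, rfl⟩, rfl⟩
    -- On a single face the transformation in direction `j` is constant, so the diagonal part
    -- absorbs it.
    refine ⟨(g.1 + Pi.single j (if b then g.2 j else 0), g.2), funext fun ε => ?_⟩
    simp only [cubeActionErase, cubeAction, ρ]
    congr 1
    funext i
    by_cases hi : i = j
    · subst hi
      simp
    · simp [hi]
  have h2 := (h.cubeActionErase j).mem_closure_orbit_symm h1
  simp only [← hcomm] at h2
  obtain ⟨c', hc', hw⟩ := IsDistalAction.exists_mem_closure_range_of_mem_closure_range hρ h2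
  refine ⟨c', hc', fun ε hε => ?_⟩
  have := congrFun hw ε
  simp only [ρ] at this
  rwa [← hε, Function.update_eq_self] at this

theorem apply_mem_closure_of_mem_cubesAt [TopologicalSpace Z] {w : Z} {c : (Fin d → Bool) → Z}
    (hc : c ∈ cubesAt φ w) (ε : Fin d → Bool) : c ε ∈ closure (range fun n => φ n w) := by
  refine closure_mono ?_ (image_closure_subset_closure_image (continuous_apply ε) ⟨c, hc, rfl⟩)
  rintro _ ⟨_, ⟨g, rfl⟩, rfl⟩
  exact ⟨_, rfl⟩

end CubeAction

/-! ### Reduction to almost constant cubes, and their lifting -/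

namespace ZdSystem

section

variable {d : ℕ} {X : Type*}

/-- Density of the orbit of `x` places all cubes in one orbit closure of the distal cube action,
where points can be moved to one another. -/
theorem mem_cubesAt_of_mem_cubes [TopologicalSpace X] {S : ZdSystem d X} (hS : S.IsMinimal)
    {c : (Fin d → Bool) → X} (hc : c ∈ S.cubes) (x : X) :
    c ∈ cubesAt (fun n x => S.pow n x) x := by
  refine closure_minimal ?_ isClosed_closure hc
  rintro _ ⟨z, n, rfl⟩
  have hz : z ∈ closure (range fun k => S.pow k x) := by
    rw [← orbit_eq_range]
    exact hS x z
  have hcont : Continuous fun z : X => fun ε : Fin d → Bool =>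
      S.pow (fun i => if ε i then n i else 0) z :=
    continuous_pi fun ε => (S.pow _).continuous
  refine closure_mono ?_ (image_closure_subset_closure_image hcont ⟨z, hz, rfl⟩)
  rintro _ ⟨_, ⟨k, rfl⟩, rfl⟩
  refine ⟨(k, n), funext fun ε => ?_⟩
  simp only [cubeAction]
  rw [add_comm, pow_add_apply]

/-- Bounding the distance along whole orbits lets the bound survive repeated limits. -/
theorem le_dist_pow_of_mem_closure [MetricSpace X] (S : ZdSystem d X) {Γ : Type*}
    {f : Γ → Fin d → ℤ} {x y : X} {δ : ℝ} (h : ∀ n, δ ≤ dist (S.pow n x) (S.pow n y)) {p : X × X}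
    (hp : p ∈ closure (range fun g => (S.pow (f g) x, S.pow (f g) y))) (n : Fin d → ℤ) :
    δ ≤ dist (S.pow n p.1) (S.pow n p.2) := by
  have hc : Continuous fun p : X × X => (S.pow n p.1, S.pow n p.2) :=
    ((S.pow n).continuous.comp continuous_fst).prodMk ((S.pow n).continuous.comp continuous_snd)
  refine le_dist_of_mem_closure (p := (S.pow n p.1, S.pow n p.2)) (fun g => h (n + f g)) ?_
  refine closure_mono ?_ (image_closure_subset_closure_image hc ⟨p, hp, rfl⟩)
  rintro _ ⟨_, ⟨g, rfl⟩, rfl⟩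
  exact ⟨g, by simp only [pow_add_apply]⟩

/-- If the unique closing property fails, then it fails for a cube all of whose vertices but
one are equal. -/
theorem exists_mem_cubesAt_of_ne [MetricSpace X] [CompactSpace X] {S : ZdSystem d X}
    (hmin : S.IsMinimal) (hdist : S.IsDistal) {a b : (Fin d → Bool) → X} (ha : a ∈ S.cubes)
    (hb : b ∈ S.cubes) {ε₀ : Fin d → Bool} (hab : ∀ ε, ε ≠ ε₀ → a ε = b ε) (hne : a ε₀ ≠ b ε₀) :
    ∃ (x : X) (c : (Fin d → Bool) → X) (δ : ℝ), 0 < δ ∧ c ∈ cubesAt (fun n x => S.pow n x) x ∧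
      (∀ ε, ε ≠ ε₀ → c ε = x) ∧ ∀ n, δ ≤ dist (S.pow n x) (S.pow n (c ε₀)) := by
  let x := a ε₀
  obtain ⟨δ, hδ, hle⟩ := hdist.exists_le_dist hne
  have hA := hdist.isDistalAction.cubeAction
  -- Move `a` to the constant `x` and carry `b` along; the limit of `b` is `c`.
  obtain ⟨⟨a', c⟩, hac, rfl : a' = fun _ => x⟩ :=
    IsDistalAction.exists_mem_closure_range_of_mem_closure_range
      (f := fun g => (cubeAction (fun n x => S.pow n x) g a, cubeAction (fun n x => S.pow n x) g b))
      continuous_fst (hA.mem_closure_orbit_symm (mem_cubesAt_of_mem_cubes hmin ha x))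
  refine ⟨x, c, δ, hδ, ?_, fun ε hε => ?_, ?_⟩
  · refine hA.mem_closure_orbit_trans (mem_cubesAt_of_mem_cubes hmin hb x) (closure_mono ?_
      (image_closure_subset_closure_image continuous_snd ⟨_, hac, rfl⟩))
    rintro _ ⟨_, ⟨g, rfl⟩, rfl⟩
    exact ⟨g, rfl⟩
  · have hcl : IsClosed {p : ((Fin d → Bool) → X) × ((Fin d → Bool) → X) | p.1 ε = p.2 ε} :=
      isClosed_eq (by fun_prop) (by fun_prop)
    refine (closure_minimal ?_ hcl hac : x = c ε).symm
    rintro _ ⟨g, rfl⟩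
    exact congrArg (S.pow _) (hab ε hε)
  · have hc : Continuous fun p : ((Fin d → Bool) → X) × ((Fin d → Bool) → X) =>
      (p.1 ε₀, p.2 ε₀) := by fun_prop
    refine S.le_dist_pow_of_mem_closure (Γ := (Fin d → ℤ) × (Fin d → ℤ))
      (f := fun g => g.1 + fun i => if ε₀ i then g.2 i else 0) (p := (x, c ε₀)) hle
      (closure_mono ?_ (image_closure_subset_closure_image hc ⟨_, hac, rfl⟩))
    rintro _ ⟨_, ⟨g, rfl⟩, rfl⟩
    exact ⟨g, rfl⟩

/-- A cube which is constant except at the vertex `ε₀` lifts, up to a change of its vertex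
`ε₀`, to a cube with the same property in an extension. -/
theorem exists_lift_mem_cubesAt [MetricSpace X] {S : ZdSystem d X} {Z : Type*}
    [TopologicalSpace Z] [CompactSpace Z] [T2Space Z] {φ : (Fin d → ℤ) → Z → Z}
    (hφ : IsDistalAction φ) {p : Z → X} (hp : Continuous p)
    (hequiv : ∀ n z, p (φ n z) = S.pow n (p z)) (w : Z) {c : (Fin d → Bool) → X}
    (hc : c ∈ cubesAt (fun n x => S.pow n x) (p w)) {ε₀ : Fin d → Bool} {δ : ℝ}
    (hcx : ∀ ε, ε ≠ ε₀ → c ε = p w) (hle : ∀ n, δ ≤ dist (S.pow n (p w)) (S.pow n (c ε₀)))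
    (D : Finset (Fin d)) :
    ∃ c' ∈ cubesAt φ w, (∀ ε, (∃ i ∈ D, ε i ≠ ε₀ i) → c' ε = w) ∧
      (∀ ε, ε ≠ ε₀ → p (c' ε) = p w) ∧
      ∀ n, δ ≤ dist (S.pow n (p w)) (S.pow n (p (c' ε₀))) := by
  induction D using Finset.induction_on with
  | empty =>
    have hp' : Continuous fun (c : (Fin d → Bool) → Z) ε => p (c ε) :=
      continuous_pi fun ε => hp.comp (continuous_apply ε)
    have hc' : c ∈ closure (range fun g => (fun (c : (Fin d → Bool) → Z) ε => p (c ε))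
        (cubeAction φ g fun _ => w)) := by
      simp only [cubeAction, hequiv]
      exact hc
    obtain ⟨c₁, hc₁, rfl⟩ := IsDistalAction.exists_mem_closure_range_of_mem_closure_range hp' hc'
    exact ⟨c₁, hc₁, by simp, hcx, hle⟩
  | insert j D hj ih =>
    obtain ⟨c₁, hc₁, hw₁, hx₁, hle₁⟩ := ih
    -- Straighten the face opposite to `ε₀` in direction `j`. The motion is the same at both ends of
    -- a `j`-edge, so equalities and distance bounds along such edges persist.
    obtain ⟨c₂, hc₂, hw₂⟩ := exists_mem_closure_cubeActionErase hφ hc₁ j (!ε₀ j)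
    have hne : ∀ ε : Fin d → Bool, ε j ≠ ε₀ j → ε j = !ε₀ j := fun ε h => by
      cases h₁ : ε j <;> cases h₂ : ε₀ j <;> simp_all
    have hupd : ∀ ε : Fin d → Bool, Function.update ε j (!ε₀ j) ≠ ε₀ := fun ε h => by
      have := congrFun h j
      simp at this
    have hw₂' : ∀ ε : Fin d → Bool, c₂ (Function.update ε j (!ε₀ j)) = w := fun ε =>
      hw₂ _ (Function.update_self _ _ _)
    refine ⟨c₂, mem_cubesAt_of_mem_closure_cubeActionErase hφ hc₁ hc₂, ?_, ?_, ?_⟩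
    · rintro ε ⟨i, hi, hεi⟩
      by_cases hεj : ε j = ε₀ j
      · have hij : i ≠ j := by
          rintro rfl
          exact hεi hεj
        have hiD : i ∈ D := (Finset.mem_insert.1 hi).resolve_left hij
        have hcl : IsClosed {c : (Fin d → Bool) → Z |
            c ε = c (Function.update ε j (!ε₀ j))} := isClosed_eq (by fun_prop) (by fun_prop)
        refine (closure_minimal ?_ hcl hc₂ : c₂ ε = c₂ (Function.update ε j (!ε₀ j))).trans
          (hw₂' ε)
        rintro _ ⟨g, rfl⟩
        change cubeActionErase φ j g c₁ ε = cubeActionErase φ j g c₁ (Function.update ε j (!ε₀ j))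
        -- Both ends of this `j`-edge differ from `ε₀` at `i ∈ D`, so both were already `w` in `c₁`.
        rw [cubeActionErase_apply_update, hw₁ _ ⟨i, hiD, by simpa [hij] using hεi⟩,
          ← hw₁ ε ⟨i, hiD, hεi⟩]
        rfl
      · exact hw₂ ε (hne ε hεj)
    · intro ε hε
      have hcl : IsClosed {c : (Fin d → Bool) → Z |
          p (c ε) = p (c (Function.update ε j (!ε₀ j)))} :=
        isClosed_eq (by fun_prop) (by fun_prop)
      rw [← hw₂' ε]
      refine (closure_minimal ?_ hcl hc₂ : p (c₂ ε) = p (c₂ (Function.update ε j (!ε₀ j))))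
      rintro _ ⟨g, rfl⟩
      change p (cubeActionErase φ j g c₁ ε) =
        p (cubeActionErase φ j g c₁ (Function.update ε j (!ε₀ j)))
      rw [cubeActionErase_apply_update, hequiv, hx₁ _ (hupd ε), ← hx₁ ε hε, ← hequiv]
      rfl
    · have hcont : Continuous fun c : (Fin d → Bool) → Z =>
          (p (c (Function.update ε₀ j (!ε₀ j))), p (c ε₀)) := by fun_prop
      rw [← hw₂' ε₀]
      refine S.le_dist_pow_of_mem_closure (Γ := (Fin d → ℤ) × (Fin d → ℤ))
        (f := fun g => g.1 + fun i => if ε₀ i then Function.update g.2 j 0 i else 0)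
        (p := (p (c₂ (Function.update ε₀ j (!ε₀ j))), p (c₂ ε₀))) hle₁
        (closure_mono ?_ (image_closure_subset_closure_image hcont ⟨c₂, hc₂, rfl⟩))
      rintro _ ⟨_, ⟨g, rfl⟩, rfl⟩
      refine ⟨g, Prod.ext ?_ ?_⟩
      · simp only [cubeActionErase_apply_update, hequiv, hx₁ _ (hupd ε₀)]
      · simp only [cubeActionErase, cubeAction, hequiv]

end

/-! ### The joining with the `Y_i` and the converse -/

section Joining

variable {m : ℕ} {X : Type*} [MetricSpace X] {Y : Fin (m + 1) → Type*} [∀ i, MetricSpace (Y i)]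

/-- The action of `ℤ^{m+1}` on `X × ∏ Y_i` in which the `i`-th transformation acts trivially
on `Y_i`. -/
def joiningAction (S : ZdSystem (m + 1) X) (R : ∀ i, ZdSystem m (Y i)) (n : Fin (m + 1) → ℤ)
    (z : X × ∀ i, Y i) : X × ∀ i, Y i :=
  (S.pow n z.1, fun i => (R i).pow (fun k => n (i.succAbove k)) (z.2 i))

theorem isDistalAction_joiningAction {S : ZdSystem (m + 1) X} {R : ∀ i, ZdSystem m (Y i)}
    (hS : S.IsDistal) (hR : ∀ i, (R i).IsDistal) : IsDistalAction (joiningAction S R) :=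
  hS.isDistalAction.prod (IsDistalAction.pi fun i =>
    (hR i).isDistalAction.comap (fun (n : Fin (m + 1) → ℤ) k => n (i.succAbove k))
      fun _ _ => rfl)

theorem exists_pow_mem_of_mem_cubesAt [CompactSpace X] [∀ i, CompactSpace (Y i)]
    {S : ZdSystem (m + 1) X} {R : ∀ i, ZdSystem m (Y i)} (hS : S.IsDistal)
    (hR : ∀ i, (R i).IsDistal) {x : X} {y : ∀ i, Y i} {V : ∀ i, Set (Y i)}
    (hV : ∀ i, IsOpen (V i)) (hy : ∀ i, y i ∈ V i) {c : (Fin (m + 1) → Bool) → X}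
    (hc : c ∈ cubesAt (fun n x => S.pow n x) x) {ε₀ : Fin (m + 1) → Bool} {δ : ℝ} (hδ : 0 < δ)
    (hcx : ∀ ε, ε ≠ ε₀ → c ε = x) (hle : ∀ n, δ ≤ dist (S.pow n x) (S.pow n (c ε₀))) :
    ∃ n, (∀ i, (R i).pow (fun k => n (i.succAbove k)) (y i) ∈ V i) ∧
      δ / 2 < dist x (S.pow n x) := by
  obtain ⟨c', hc', hw, -, hle'⟩ := exists_lift_mem_cubesAt (isDistalAction_joiningAction hS hR)
    continuous_fst (fun _ _ => rfl) (x, y) hc hcx hle Finset.univ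
  have hy' : (c' ε₀).2 = y := by
    funext i
    have hcl : IsClosed {c : (Fin (m + 1) → Bool) → X × ∀ i, Y i |
        (c ε₀).2 i = (c (Function.update ε₀ i (!ε₀ i))).2 i} :=
      isClosed_eq (by fun_prop) (by fun_prop)
    -- The `i`-th transformation is trivial on `Y i`, so `i`-edges are constant there.
    have heq : (c' ε₀).2 i = (c' (Function.update ε₀ i (!ε₀ i))).2 i := by
      refine closure_minimal ?_ hcl hc'
      rintro _ ⟨g, rfl⟩
      simp [cubeAction, joiningAction]
    rw [heq, hw _ ⟨i, Finset.mem_univ i, by simp⟩]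
  have hopen : IsOpen {z : X × ∀ i, Y i | δ / 2 < dist x z.1 ∧ ∀ i, z.2 i ∈ V i} := by
    have hd : IsOpen {z : X × ∀ i, Y i | δ / 2 < dist x z.1} :=
      isOpen_lt (by fun_prop) (by fun_prop)
    have : IsOpen (⋂ i, {z : X × ∀ i, Y i | z.2 i ∈ V i}) :=
      isOpen_iInter_of_finite fun i => (hV i).preimage (by fun_prop)
    convert hd.inter this using 1
    ext z
    simp
  have hmem : c' ε₀ ∈ {z : X × ∀ i, Y i | δ / 2 < dist x z.1 ∧ ∀ i, z.2 i ∈ V i} := by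
    refine ⟨?_, fun i => hy' ▸ hy i⟩
    have := hle' 0
    simp only [pow_zero_apply] at this
    linarith
  obtain ⟨_, ⟨hn, hnV⟩, n, rfl⟩ :=
    mem_closure_iff.1 (apply_mem_closure_of_mem_cubesAt hc' ε₀) _ hopen hmem
  exact ⟨n, hnV, hn⟩

/-- The radius `δ / 2` is chosen because orbit points approximating the exceptional vertex stay more
than `δ / 2` from `x`. -/
theorem uniqueClosingParallelepiped_of_exists_setJoining_subset {X : Type u} [MetricSpace X]
    [CompactSpace X] {S : ZdSystem (m + 1) X} (hmin : S.IsMinimal) (hdist : S.IsDistal)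
    (h : ∀ (x : X) (U : Set X), IsOpen U → x ∈ U → ∃ B : Fin (m + 1) → Set (Fin m → ℤ),
      (∀ i, IsMinimalDistalReturnTimeSet.{u} (B i)) ∧ setJoining B ⊆ S.returnTimes x U) :
    S.UniqueClosingParallelepiped := by
  intro a ha b hb ε₀ hab
  by_contra hne
  have hne' : a ε₀ ≠ b ε₀ := fun he => hne <| funext fun ε => by
    by_cases hε : ε = ε₀
    · rw [hε, he]
    · exact hab ε hε
  obtain ⟨x, c, δ, hδ, hc, hcx, hle⟩ := exists_mem_cubesAt_of_ne hmin hdist ha hb hab hne'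
  obtain ⟨B, hB, hsub⟩ := h x (Metric.ball x (δ / 2)) Metric.isOpen_ball
    (Metric.mem_ball_self (half_pos hδ))
  choose Y hY hcomp R _ hR y V hV hy hVB using hB
  obtain ⟨n, hn, hdn⟩ := exists_pow_mem_of_mem_cubesAt hdist hR hV hy hc hδ hcx hle
  have : S.pow n x ∈ Metric.ball x (δ / 2) := hsub fun i => hVB i (hn i)
  rw [Metric.mem_ball, dist_comm] at this
  exact this.not_gt hdn

end Joining

end ZdSystem

theorem mainTheorem8 (m : ℕ) (hm : 2 ≤ m + 1) {X : Type u} [MetricSpace X] [CompactSpace X]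
    (S : ZdSystem (m + 1) X) (hmin : S.IsMinimal) (hdist : S.IsDistal) :
    S.UniqueClosingParallelepiped ↔
      ∀ (x : X) (U : Set X), IsOpen U → x ∈ U →
        ∃ B : Fin (m + 1) → Set (Fin m → ℤ),
          (∀ i, IsMinimalDistalReturnTimeSet.{u} (B i)) ∧
            setJoining B ⊆ S.returnTimes x U :=
  ⟨fun h _ _ hU hx => h.exists_setJoining_subset hdist hU hx,
    ZdSystem.uniqueClosingParallelepiped_of_exists_setJoining_subset hmin hdist⟩
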